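/- **Setting.** Let $R$ be a commutative ring with $m$ commuting derivations $\partial_1,\dots,\partial_m$ and an action $g\mapsto\hat g$ of a discrete group $\Gamma$ by ring automorphisms commuting with the $\partial_l$ ($\Gamma$ trivial: a differential ring; $\Gamma$ trivial and $m=0$: the finite-dimensional case). For an extension $A\supseteq R$ of such rings and $a,b\in A$ write $a\sim b$ if $a-b\in\sum_l\operatorname{Im}\partial_l+\sum_{g\in\Gamma}\operatorname{Im}(\hat g-\hat e)$. For $u,X\in A^N$ put $\langle u,X\rangle=\sum_i u_iX_i$. Linear (bilinear) operators below are differential-difference operators over $R$: their components are finite sums of terms $c\,\hat g\partial^\sigma(x_j)$ (respectively $c\,\hat g\partial^\sigma(x_j)\,\hat h\partial^\tau(y_k)$) with $c\in R$; they act on vectors over every extension $A$ of $R$, and identities between them are required over every extension. Let $\mathcal G=R^N$ be a Lie algebra, i.e. it carries a skewsymmetric bilinear operator $[\ ,\ ]$ satisfying the Jacobi identity. Let $\chi$ be a representation of $\mathcal G$ on $V=R^n$, i.e. a bilinear operator $(X,v)\mapsto X.v=\chi(X)(v)$ with $[X,Y].v=X.(Y.v)-Y.(X.v)$. Put $\mathcal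 G^*=R^N$ and $V^*=R^n$, and let the coadjoint action $X^{\cdot}u\in\mathcal G^*$ and the map $\nabla:V\times V^*\to\mathcal G^*$ be the bilinear operators determined by $$\langle X^{\cdot}u,Y\rangle\sim-\langle u,[X,Y]\rangle,\qquad \langle v\nabla v^*,X\rangle\sim\langle v^*,X.v\rangle .$$ Let $\mathcal O:\mathcal G^*\to\mathcal G$ be a skewsymmetric $\mathcal O$-operator, i.e. a linear operator such that, for all $u,v$, $$\langle u,\mathcal O(v)\rangle+\langle v,\mathcal O(u)\rangle\sim0,\qquad \mathcal O\big(\mathcal O(u)^{\cdot}v-\mathcal O(v)^{\cdot}u\big)=[\mathcal O(u),\mathcal O(v)].$$ Let $\operatorname{Fun}(V\oplus V^*)=R[x_\alpha^{(g|\sigma)},p_\alpha^{(g|\sigma)}]$ ($1\le\alpha\le n$, $g\in\Gamma$, $\sigma\in\mathbb Z_+^m$) be the polynomial ring in which $\partial_l$ and $\hat h$ extend the given maps on $R$ by $\partial_l q^{(g|\sigma)}=q^{(g|\sigma+1_l)}$ and $\hat h q^{(g|\sigma)}=q^{(hg|\sigma)}$. Write $x=(x_\alpha^{(e|0)})_\alpha$,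 $p=(p_\alpha^{(e|0)})_\alpha$, and for each $q\in\{x_\alpha,p_\alpha\}$ let $$\frac{\delta H}{\delta q}=\sum_{g,\sigma}(-\partial)^\sigma\hat g^{-1}\Big(\frac{\partial H}{\partial q^{(g|\sigma)}}\Big).$$ The quadratic bracket on $\operatorname{Fun}(V\oplus V^*)$, defined modulo $\sim$, is $$\begin{aligned}\{H,F\}\sim{}&\Big\langle x\nabla\tfrac{\delta H}{\delta x},\mathcal O\big(x\nabla\tfrac{\delta F}{\delta x}\big)\Big\rangle-\Big\langle \tfrac{\delta H}{\delta p}\nabla p,\mathcal O\big(x\nabla\tfrac{\delta F}{\delta x}\big)\Big\rangle\\&-\Big\langle x\nabla\tfrac{\delta H}{\delta x},\mathcal O\big(\tfrac{\delta F}{\delta p}\nabla p\big)\Big\rangle+\Big\langle \tfrac{\delta H}{\delta p}\nabla p,\mathcal O\big(\tfrac{\delta F}{\delta p}\nabla p\big)\Big\rangle .\end{aligned}$$ **Proposition 9.1.** This bracket satisfies the Jacobi identity: for all $H,F,G\in\operatorname{Fun}(V\oplus V^*)$, $$\{\{H,F\},G\}+\{\{F,G\},H\}+\{\{G,H\},F\}\sim0.$$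 -/

import Mathlib

universe u v

namespace DiffDiff

/-- Indices `(g, σ)` of the monomial operators `ĝ ∂^σ`. -/
abbrev OpIdx (m : ℕ) (Γ : Type v) : Type v := Γ × (Fin m →₀ ℕ)

/-- A differential-difference ring: a commutative ring with `m` commuting derivations and an action
of the discrete group `Γ` by automorphisms commuting with the derivations. For `Γ` trivial
this is a differential ring; for `Γ` trivial and `m = 0` it is just a commutative ring. -/
class DDRing (m : ℕ) (Γ : Type v) [Group Γ] (A : Type u) [CommRing A] where
  der : Fin m → Derivation ℤ A A
  sh : Γ →* (A →+* A)
  der_comm : ∀ (i j : Fin m) (a : A), der i (der j a) = der j (der i a)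
  der_sh : ∀ (i : Fin m) (g : Γ) (a : A), der i (sh g a) = sh g (der i a)

section Ring

variable {m : ℕ} {Γ : Type v} [Group Γ] {A : Type u} [CommRing A] [DDRing m Γ A]

/-- `∂^σ = ∂₁^σ₁ ⋯ ∂ₘ^σₘ`. -/
def derPow (Γ : Type v) [Group Γ] [DDRing m Γ A] (σ : Fin m →₀ ℕ) : Module.End ℤ A :=
  (List.ofFn fun l : Fin m =>
    ((DDRing.der (Γ := Γ) l : Derivation ℤ A A) : A →ₗ[ℤ] A) ^ σ l).prod

/-- The monomial operator `ĝ ∂^σ`. -/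
def mono (k : OpIdx m Γ) (a : A) : A := DDRing.sh m k.1 (derPow Γ k.2 a)

/-- The adjoint `(-∂)^σ ĝ⁻¹` of the monomial operator `ĝ ∂^σ`. -/
def monoAdj (k : OpIdx m Γ) (a : A) : A :=
  (-1) ^ (∑ l, k.2 l) * derPow Γ k.2 (DDRing.sh m k.1⁻¹ a)

variable (m Γ) in
/-- The subgroup `∑ Im ∂ₗ + ∑ Im (ĝ - ê)` of trivial elements. -/
def trivials (A : Type u) [CommRing A] [DDRing m Γ A] : AddSubgroup A :=
  AddSubgroup.closure
    ({a | ∃ (l : Fin m) (b : A), a = DDRing.der (Γ := Γ) l b} ∪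
      {a | ∃ (g : Γ) (b : A), a = DDRing.sh m g b - b})

variable (m Γ) in
/-- `a ∼ b`: equality modulo `∑ Im ∂ₗ + ∑ Im (ĝ - ê)`. -/
def Sim (a b : A) : Prop := a - b ∈ trivials m Γ A

/-- The pairing `⟨u, X⟩ = uᵗ X`. -/
def pair {I : Type} [Fintype I] (a b : I → A) : A := ∑ i, a i * b i

end Ring

/-- `A` is a differential-difference extension of `R`. -/
structure IsDDExt (m : ℕ) (Γ : Type v) [Group Γ] (R : Type*) [CommRing R] [DDRing m Γ R]
    (A : Type*) [CommRing A] [DDRing m Γ A] [Algebra R A] : Prop where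
  injective : Function.Injective (algebraMap R A)
  map_der : ∀ (l : Fin m) (r : R),
    algebraMap R A (DDRing.der (Γ := Γ) l r) = DDRing.der (Γ := Γ) l (algebraMap R A r)
  map_sh : ∀ (g : Γ) (r : R),
    algebraMap R A (DDRing.sh m g r) = DDRing.sh m g (algebraMap R A r)

section Operators

/-- Linear differential-difference operators `R^J → R^I`, as matrices of finite sums `∑ c ĝ ∂^σ`
with coefficients in `R`. -/
abbrev LinOp (m : ℕ) (Γ : Type v) (R : Type u) [CommRing R] (I J : Type) : Type (max u v) :=
  I → J → (OpIdx m Γ →₀ R)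

/-- Bilinear differential-difference operators `R^J × R^K → R^I`: the `i`-th component is a finite
sum of terms `c · ĝ ∂^σ (x j) · ĥ ∂^τ (y k)` with coefficients `c` in `R`. -/
abbrev BilOp (m : ℕ) (Γ : Type v) (R : Type u) [CommRing R] (I J K : Type) : Type (max u v) :=
  I → J → K → (OpIdx m Γ × OpIdx m Γ →₀ R)

variable {m : ℕ} {Γ : Type v} [Group Γ] {R : Type u} [CommRing R]
  {A : Type*} [CommRing A] [DDRing m Γ A] [Algebra R A]
  {I J K : Type} [Fintype I] [Fintype J] [Fintype K]

/-- The action of a linear operator over `R` on vectors with entries in an extension `A`. -/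
def LinOp.eval (L : LinOp m Γ R I J) (x : J → A) : I → A := fun i =>
  ∑ j, (L i j).sum fun s c => algebraMap R A c * mono s (x j)

/-- The action of a bilinear operator over `R` on vectors with entries in an extension `A`. -/
def BilOp.eval (b : BilOp m Γ R I J K) (x : J → A) (y : K → A) : I → A := fun i =>
  ∑ j, ∑ k, (b i j k).sum fun s c => algebraMap R A c * mono s.1 (x j) * mono s.2 (y k)

/-- The adjoint of `x ↦ b (x, y)` applied to `w`:  `⟨adjFst b w y, x⟩ ∼ ⟨w, b (x, y)⟩`. -/
def BilOp.adjFst (b : BilOp m Γ R I J K) (w : I → A) (y : K → A) : J → A := fun j =>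
  ∑ i, ∑ k, (b i j k).sum fun s c => monoAdj s.1 (algebraMap R A c * w i * mono s.2 (y k))

/-- The adjoint of `y ↦ b (x, y)` applied to `w`:  `⟨adjSnd b w x, y⟩ ∼ ⟨w, b (x, y)⟩`. -/
def BilOp.adjSnd (b : BilOp m Γ R I J K) (w : I → A) (x : J → A) : K → A := fun k =>
  ∑ i, ∑ j, (b i j k).sum fun s c => monoAdj s.2 (algebraMap R A c * w i * mono s.1 (x j))

end Operators

/-- A differential-difference Lie algebra structure on `R^N`: a bilinear differential-difference
operator satisfying skewsymmetry and the Jacobi identity over every extension of `R`. -/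
structure LieStr (m : ℕ) (Γ : Type v) [Group Γ] (R : Type u) [CommRing R] [DDRing m Γ R]
    (N : ℕ) where
  op : BilOp m Γ R (Fin N) (Fin N) (Fin N)
  skew : ∀ (A : Type (max u v)) [CommRing A] [DDRing m Γ A] [Algebra R A], IsDDExt m Γ R A →
    ∀ x y : Fin N → A, op.eval x y = - op.eval y x
  jacobi : ∀ (A : Type (max u v)) [CommRing A] [DDRing m Γ A] [Algebra R A], IsDDExt m Γ R A →
    ∀ x y z : Fin N → A,
      op.eval (op.eval x y) z + op.eval (op.eval y z) x + op.eval (op.eval z x) y = 0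

/-- A representation `χ` of the Lie algebra `R^N` on `V = R^n` by differential-difference
operators; `op.eval X v` is `X.v = χ(X)(v)`. -/
structure DDRep {m : ℕ} {Γ : Type v} [Group Γ] {R : Type u} [CommRing R] [DDRing m Γ R]
    {N : ℕ} (𝒢 : LieStr m Γ R N) (n : ℕ) where
  op : BilOp m Γ R (Fin n) (Fin N) (Fin n)
  map_lie : ∀ (A : Type (max u v)) [CommRing A] [DDRing m Γ A] [Algebra R A], IsDDExt m Γ R A →
    ∀ (X Y : Fin N → A) (w : Fin n → A),
      op.eval (𝒢.op.eval X Y) w = op.eval X (op.eval Y w) - op.eval Y (op.eval X w)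

section Constructions

variable {m : ℕ} {Γ : Type v} [Group Γ] {R : Type u} [CommRing R] [DDRing m Γ R]
  {A : Type*} [CommRing A] [DDRing m Γ A] [Algebra R A] {N n : ℕ}

/-- The coadjoint action `X˙u` on `𝒢* = R^N`:  `⟨X˙u, Y⟩ ∼ -⟨u, [X, Y]⟩` for all `Y`. -/
def LieStr.coad (𝒢 : LieStr m Γ R N) (X u : Fin N → A) : Fin N → A := - 𝒢.op.adjSnd u X

/-- The map `∇ : V × V* → 𝒢*`:  `⟨v ∇ w, X⟩ ∼ ⟨w, χ(X)(v)⟩` for all `X`. -/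
def DDRep.nabla {𝒢 : LieStr m Γ R N} (χ : DDRep 𝒢 n) (v w : Fin n → A) : Fin N → A :=
  χ.op.adjFst w v

/-- A (skewsymmetric) `𝒪`-operator `𝒢* → 𝒢`; both identities are identities between operators,
that is, they hold over every extension of `R`. -/
structure IsOOperator (𝒢 : LieStr m Γ R N) (O : LinOp m Γ R (Fin N) (Fin N)) : Prop where
  skew : ∀ (A : Type (max u v)) [CommRing A] [DDRing m Γ A] [Algebra R A], IsDDExt m Γ R A →
    ∀ a b : Fin N → A, Sim m Γ (pair a (O.eval b) + pair b (O.eval a)) 0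
  hom : ∀ (A : Type (max u v)) [CommRing A] [DDRing m Γ A] [Algebra R A], IsDDExt m Γ R A →
    ∀ a b : Fin N → A,
      O.eval (𝒢.coad (O.eval a) b - 𝒢.coad (O.eval b) a) = 𝒢.op.eval (O.eval a) (O.eval b)

end Constructions

section Polynomials

/-- The ring `R[q_i^{(g|σ)}]`, `i ∈ ι`, of differential-difference polynomials. -/
abbrev DDPoly (m : ℕ) (Γ : Type v) (R : Type u) [CommRing R] (ι : Type) : Type (max u v) :=
  MvPolynomial (ι × OpIdx m Γ) R

variable {m : ℕ} {Γ : Type v} [Group Γ] {R : Type u} [CommRing R] [DDRing m Γ R] {ι : Type}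

/-- The ring homomorphism `f ↦ f + ε ∂ₗ f` into the dual numbers that determines the extension of
`∂ₗ` with `∂ₗ q_i^{(g|σ)} = q_i^{(g|σ + 1ₗ)}`. -/
noncomputable def polyDerHom (l : Fin m) :
    DDPoly m Γ R ι →+* DualNumber (DDPoly m Γ R ι) :=
  MvPolynomial.eval₂Hom
    { toFun := fun r => TrivSqZeroExt.inl (MvPolynomial.C r) +
        TrivSqZeroExt.inr (MvPolynomial.C (DDRing.der (Γ := Γ) l r))
      map_one' := by simp
      map_zero' := by simp
      map_mul' := fun a b => by
        ext <;> simp [mul_comm, add_comm]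
      map_add' := fun a b => by
        ext <;> simp }
    (fun q => TrivSqZeroExt.inl (MvPolynomial.X q) +
      TrivSqZeroExt.inr (MvPolynomial.X (q.1, q.2.1, q.2.2 + Finsupp.single l 1)))

theorem polyDerHom_fst (l : Fin m) (f : DDPoly m Γ R ι) : (polyDerHom l f).fst = f := by
  induction f using MvPolynomial.induction_on with
  | C a => simp [polyDerHom]
  | add p q hp hq => simp [hp, hq]
  | mul_X p q hp => simp [hp]; simp [polyDerHom]

/-- The extension of `∂ₗ` to `R[q_i^{(g|σ)}]`. -/
noncomputable def polyDer (l : Fin m) : Derivation ℤ (DDPoly m Γ R ι) (DDPoly m Γ R ι) where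
  toFun f := (polyDerHom l f).snd
  map_add' f g := by simp
  map_smul' z f := by simp
  map_one_eq_zero' := by simp
  leibniz' f g := by simp [polyDerHom_fst, mul_comm]

/-- The extension of `ĝ` to `R[q_i^{(h|σ)}]` with `ĝ q_i^{(h|σ)} = q_i^{(gh|σ)}`. -/
noncomputable def polySh (g : Γ) : DDPoly m Γ R ι →+* DDPoly m Γ R ι :=
  MvPolynomial.eval₂Hom (MvPolynomial.C.comp (DDRing.sh m g))
    (fun q => MvPolynomial.X (q.1, g * q.2.1, q.2.2))

theorem polyDer_C (l : Fin m) (r : R) :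
    polyDer l (MvPolynomial.C r : DDPoly m Γ R ι) =
      MvPolynomial.C (DDRing.der (Γ := Γ) l r) := by
  change (polyDerHom l (MvPolynomial.C r : DDPoly m Γ R ι)).snd = _
  simp [polyDerHom]

theorem polyDer_X (l : Fin m) (q : ι × OpIdx m Γ) :
    polyDer l (MvPolynomial.X q : DDPoly m Γ R ι) =
      MvPolynomial.X (q.1, q.2.1, q.2.2 + Finsupp.single l 1) := by
  change (polyDerHom l (MvPolynomial.X q : DDPoly m Γ R ι)).snd = _
  simp [polyDerHom]

theorem polySh_C (g : Γ) (r : R) :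
    polySh g (MvPolynomial.C r : DDPoly m Γ R ι) = MvPolynomial.C (DDRing.sh m g r) := by
  simp [polySh]

theorem polySh_X (g : Γ) (q : ι × OpIdx m Γ) :
    polySh g (MvPolynomial.X q : DDPoly m Γ R ι) = MvPolynomial.X (q.1, g * q.2.1, q.2.2) := by
  simp [polySh]

noncomputable instance DDPoly.instDDRing : DDRing m Γ (DDPoly m Γ R ι) where
  der := polyDer
  sh :=
    { toFun := polySh
      map_one' := by
        apply MvPolynomial.ringHom_ext
        · intro r; simp [polySh_C]
        · intro q; simp [polySh_X]
      map_mul' := fun g h => by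
        apply MvPolynomial.ringHom_ext
        · intro r; simp [polySh_C]
        · intro q; simp [polySh_X, mul_assoc] }
  der_comm i j f := by
    change polyDer i (polyDer j f) = polyDer j (polyDer i f)
    induction f using MvPolynomial.induction_on with
    | C a => simp [polyDer_C, DDRing.der_comm i j a]
    | add p q hp hq => simp [hp, hq]
    | mul_X p q hp => simp [hp, polyDer_X]; rw [add_right_comm q.2.2]; ring
  der_sh i g f := by
    change polyDer i (polySh g f) = polySh g (polyDer i f)
    induction f using MvPolynomial.induction_on with
    | C a => simp [polyDer_C, polySh_C, DDRing.der_sh]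
    | add p q hp hq => simp [hp, hq]
    | mul_X p q hp => simp [hp, polyDer_X, polySh_X]

/-- The variational derivative `δH/δq_i = ∑ (-∂)^σ ĝ⁻¹ (∂H/∂q_i^{(g|σ)})`; only finitely many
terms are nonzero, by `varDer_finite`. -/
noncomputable def varDer (H : DDPoly m Γ R ι) (i : ι) : DDPoly m Γ R ι :=
  ∑ᶠ k : OpIdx m Γ, monoAdj k (MvPolynomial.pderiv (i, k) H)

theorem varDer_finite (H : DDPoly m Γ R ι) (i : ι) :
    (Function.support fun k : OpIdx m Γ =>
      monoAdj k (MvPolynomial.pderiv (i, k) H)).Finite := by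
  refine Set.Finite.subset
    (Set.Finite.preimage (f := fun k : OpIdx m Γ => (i, k)) (fun a _ b _ h => by simpa using h)
      H.vars.finite_toSet) ?_
  intro k hk
  by_contra hv
  apply hk
  simp [MvPolynomial.pderiv_eq_zero_of_notMem_vars (fun h => hv h), monoAdj]

end Polynomials

section Bracket

variable {m : ℕ} {Γ : Type v} [Group Γ] {R : Type u} [CommRing R] [DDRing m Γ R] {N n : ℕ}

/-- `Fun (V ⊕ V*) = R[x_α^{(g|σ)}, p_α^{(g|σ)}]`, with `inl α` indexing `x_α` and `inr α`
indexing `p_α`. -/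
abbrev FunVV (m : ℕ) (Γ : Type v) (R : Type u) [CommRing R] (n : ℕ) : Type (max u v) :=
  DDPoly m Γ R (Fin n ⊕ Fin n)

/-- The vector `x` of coordinates on `V`. -/
noncomputable def xvec : Fin n → FunVV m Γ R n := fun α => MvPolynomial.X (Sum.inl α, 1, 0)

/-- The vector `p` of coordinates on `V*`. -/
noncomputable def pvec : Fin n → FunVV m Γ R n := fun α => MvPolynomial.X (Sum.inr α, 1, 0)

/-- The vector `δH/δx`. -/
noncomputable def gradx (H : FunVV m Γ R n) : Fin n → FunVV m Γ R n := fun α =>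
  varDer H (Sum.inl α)

/-- The vector `δH/δp`. -/
noncomputable def gradp (H : FunVV m Γ R n) : Fin n → FunVV m Γ R n := fun α =>
  varDer H (Sum.inr α)

variable {𝒢 : LieStr m Γ R N}

/-- The quadratic Poisson bracket on `Fun (V ⊕ V*)`, a representative modulo `∼`. The four terms are
the values of `Nᵗ B_xx (M)`, `Nᵗ B_xp (M)`, `Nᵗ B_px (M)`, `Nᵗ B_pp (M)` at the gradients `M` of `H`
and `N` of `F`. -/
noncomputable def qbracket (χ : DDRep 𝒢 n) (O : LinOp m Γ R (Fin N) (Fin N))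
    (H F : FunVV m Γ R n) : FunVV m Γ R n :=
  pair (χ.nabla xvec (gradx H)) (O.eval (χ.nabla xvec (gradx F)))
  - pair (χ.nabla (gradp H) pvec) (O.eval (χ.nabla xvec (gradx F)))
  - pair (χ.nabla xvec (gradx H)) (O.eval (χ.nabla (gradp F) pvec))
  + pair (χ.nabla (gradp H) pvec) (O.eval (χ.nabla (gradp F) pvec))

end Bracket

end DiffDiff

open DiffDiff

/-! The bracket comes from the action of `𝒢` on `V ⊕ V*` through its momentum map. With `M_H =
momentum χ H`, bilinearity gives `{H,F} = ⟨M_H, O(M_F)⟩` (`qbracket_eq`). Let `D_X = actDer χ X` be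
the evolutionary derivation moving `x` and `p` by `X`; integration by parts gives `D_X H ∼ ⟨M_H, X⟩`
(`cls_actDer`). Computing `[D_X, D_Y]` on coordinates yields the infinitesimal equivariance `⟨D_X
M_H, Y⟩ - ⟨D_Y M_H, X⟩ ∼ -⟨M_H, [X,Y]⟩` (`cls_derivation_momentum`), even when `X`, `Y` depend on
`x`, `p`. Since `{{H,F},G} ∼ D_X ⟨M_H, O(M_F)⟩` with `X = O(M_G)`, equivariance reduces the Jacobi
sum to the cyclic sum of `⟨M_H, [O(M_F), O(M_G)]⟩`, which vanishes by `cls_oOperator_cocycle`. -/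

namespace DiffDiff

/-! ### Monomial operators and integration by parts modulo `∼`. -/

section Ring

variable {m : ℕ} {Γ : Type v} [Group Γ] {A : Type u} [CommRing A] [DDRing m Γ A]

theorem list_ofFn_pow_add {M : Type*} [Monoid M] : ∀ {k : ℕ} (f : Fin k → M)
    (_ : ∀ i j, Commute (f i) (f j)) (s t : Fin k → ℕ),
    (List.ofFn fun l => f l ^ (s l + t l)).prod =
      (List.ofFn fun l => f l ^ s l).prod * (List.ofFn fun l => f l ^ t l).prod
  | 0, _, _, _, _ => by simp
  | k + 1, f, hf, s, t => by
    have hc : Commute (f 0 ^ t 0) (List.ofFn fun l : Fin k => f l.succ ^ s l.succ).prod := by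
      refine Commute.list_prod_right _ _ fun x hx => ?_
      obtain ⟨l, rfl⟩ := (List.mem_ofFn' _ _).1 hx
      exact ((hf _ _).pow_pow _ _)
    simp only [List.ofFn_succ, List.prod_cons]
    rw [list_ofFn_pow_add (fun l : Fin k => f l.succ) (fun i j => hf _ _)
      (fun l => s l.succ) (fun l => t l.succ), pow_add]
    simp only [mul_assoc]
    rw [← mul_assoc (f 0 ^ t 0), hc.eq]
    simp only [mul_assoc]

theorem derPow_zero : derPow (m := m) (A := A) Γ 0 = 1 := by
  simp [derPow]

theorem derPow_add (σ τ : Fin m →₀ ℕ) :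
    derPow (A := A) Γ (σ + τ) = derPow Γ σ * derPow Γ τ := by
  unfold derPow
  exact list_ofFn_pow_add _ (fun i j => LinearMap.ext fun a => DDRing.der_comm i j a) _ _

theorem derPow_single (l : Fin m) (a : A) :
    derPow Γ (Finsupp.single l 1) a = DDRing.der (Γ := Γ) l a := by
  unfold derPow
  have key : ∀ {k : ℕ} (f : Fin k → Module.End ℤ A) (l : Fin k),
      (List.ofFn fun i => f i ^ (if l = i then 1 else 0)).prod = f l := by
    intro k
    induction k with
    | zero => exact fun _ l => l.elim0
    | succ k ih =>
      intro f l
      rw [List.ofFn_succ, List.prod_cons]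
      cases l using Fin.cases with
      | zero => simp [(Fin.succ_ne_zero _).symm]
      | succ l => simpa using ih (fun i => f i.succ) l
  simp only [Finsupp.single_apply]
  rw [key]
  rfl

theorem derPow_add_single (σ : Fin m →₀ ℕ) (l : Fin m) (a : A) :
    derPow Γ (σ + Finsupp.single l 1) a = DDRing.der (Γ := Γ) l (derPow Γ σ a) := by
  rw [add_comm, derPow_add, Module.End.mul_apply, derPow_single]

theorem exponent_induction {p : (Fin m →₀ ℕ) → Prop} (h0 : p 0)
    (h1 : ∀ σ l, p σ → p (σ + Finsupp.single l 1)) (σ : Fin m →₀ ℕ) : p σ := by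
  classical
  obtain ⟨s, rfl⟩ := Multiset.toFinsupp.surjective σ
  induction s using Multiset.induction_on with
  | empty => simpa using h0
  | cons a s ih =>
    rw [← Multiset.singleton_add, add_comm, map_add, Multiset.toFinsupp_singleton]
    exact h1 _ _ ih

variable (m Γ) in
/-- The class of an element modulo trivial elements. -/
def cls : A →+ A ⧸ trivials m Γ A := QuotientAddGroup.mk' _

/-- Turns `∼` into equality in an abelian group, where relations can be rewritten and combined
linearly. -/
theorem sim_iff_cls {a b : A} : Sim m Γ a b ↔ cls m Γ a = cls m Γ b := by
  unfold Sim cls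
  rw [QuotientAddGroup.mk'_apply, QuotientAddGroup.mk'_apply, QuotientAddGroup.eq,
    ← neg_mem_iff]
  simp [sub_eq_add_neg, add_comm]

theorem cls_der (l : Fin m) (a : A) : cls m Γ (DDRing.der (Γ := Γ) l a) = 0 :=
  (QuotientAddGroup.eq_zero_iff _).2 (AddSubgroup.subset_closure (Or.inl ⟨l, a, rfl⟩))

theorem cls_sh (g : Γ) (a : A) : cls m Γ (DDRing.sh m g a) = cls m Γ a := by
  rw [← sub_eq_zero, ← map_sub]
  exact (QuotientAddGroup.eq_zero_iff _).2 (AddSubgroup.subset_closure (Or.inr ⟨g, a, rfl⟩))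

theorem sh_sh_inv (g : Γ) (a : A) : DDRing.sh m g (DDRing.sh m g⁻¹ a) = a := by
  change (DDRing.sh m g * DDRing.sh m g⁻¹ : A →+* A) a = a
  rw [← map_mul]
  simp

theorem cls_mul_derPow (σ : Fin m →₀ ℕ) : ∀ a b : A,
    cls m Γ (a * derPow Γ σ b) = cls m Γ ((-1) ^ (∑ l, σ l) * derPow Γ σ a * b) := by
  induction σ using exponent_induction with
  | h0 => intro a b; simp [derPow_zero]
  | h1 σ l ih =>
    intro a b
    have h := cls_der (Γ := Γ) l (a * derPow Γ σ b)
    rw [Derivation.leibniz, map_add, smul_eq_mul, smul_eq_mul] at h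
    -- The induction hypothesis is applied with `∂ₗ a` in place of `a`, so `∂ₗ` has to pass through
    -- `∂^σ`.
    have e : DDRing.der (Γ := Γ) l (derPow Γ σ a) = derPow Γ σ (DDRing.der (Γ := Γ) l a) := by
      rw [← derPow_add_single, derPow_add, Module.End.mul_apply, derPow_single]
    rw [derPow_add_single, derPow_add_single, e, eq_neg_of_add_eq_zero_left h, mul_comm, ih,
      ← map_neg]
    congr 1
    simp [Finset.sum_add_distrib, pow_add, Finsupp.single_apply]

/-- Apply `ĝ` to the product `ĝ⁻¹a · ∂^σ b`, which leaves its class unchanged, then integrate by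
parts. -/
theorem cls_mul_mono (k : OpIdx m Γ) (a b : A) :
    cls m Γ (a * mono k b) = cls m Γ (monoAdj k a * b) := by
  have h := cls_sh (m := m) k.1 (DDRing.sh m k.1⁻¹ a * derPow Γ k.2 b)
  rw [map_mul (DDRing.sh m k.1), sh_sh_inv, cls_mul_derPow] at h
  exact h

theorem mono_add_single (g : Γ) (σ : Fin m →₀ ℕ) (l : Fin m) (a : A) :
    mono (g, σ + Finsupp.single l 1) a = DDRing.der (Γ := Γ) l (mono (g, σ) a) := by
  simp [mono, derPow_add_single, DDRing.der_sh]

theorem mono_mul (h g : Γ) (σ : Fin m →₀ ℕ) (a : A) :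
    mono (h * g, σ) a = DDRing.sh m h (mono (g, σ) a) := by
  simp [mono]

theorem mono_one (a : A) : mono ((1, 0) : OpIdx m Γ) a = a := by
  simp [mono, derPow_zero]

theorem mono_add (k : OpIdx m Γ) (a b : A) : mono k (a + b) = mono k a + mono k b := by
  simp [mono]

theorem pair_add_right {I : Type} [Fintype I] (a b c : I → A) :
    pair a (b + c) = pair a b + pair a c := by
  simp [pair, mul_add, Finset.sum_add_distrib]

theorem pair_neg_left {I : Type} [Fintype I] (a c : I → A) : pair (-a) c = -pair a c := by
  simp [pair]

theorem pair_neg_right {I : Type} [Fintype I] (a c : I → A) : pair a (-c) = -pair a c := by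
  simp [pair]

theorem pair_sub_left {I : Type} [Fintype I] (a b c : I → A) :
    pair (a - b) c = pair a c - pair b c := by
  simp [pair, sub_mul]

theorem pair_sub_right {I : Type} [Fintype I] (a b c : I → A) :
    pair a (b - c) = pair a b - pair a c := by
  simp [pair, mul_sub]

theorem pair_comm {I : Type} [Fintype I] (a b : I → A) : pair a b = pair b a := by
  simp [pair, mul_comm]

end Ring

/-! ### Adjoints of operators, and derivations compatible with `∂ₗ` and `ĝ`. -/

section Operators

variable {m : ℕ} {Γ : Type v} [Group Γ] {R : Type u} [CommRing R]
  {A : Type*} [CommRing A] [DDRing m Γ A] [Algebra R A]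
  {I J K : Type} [Fintype J] [Fintype K]

theorem LinOp.eval_add (L : LinOp m Γ R I J) (x y : J → A) :
    L.eval (x + y) = L.eval x + L.eval y := by
  ext i
  simp [LinOp.eval, mono_add, mul_add, Finsupp.sum, Finset.sum_add_distrib]

theorem LinOp.eval_sub (L : LinOp m Γ R I J) (x y : J → A) :
    L.eval (x - y) = L.eval x - L.eval y := by
  rw [eq_sub_iff_add_eq, ← L.eval_add, sub_add_cancel]

theorem BilOp.cls_adjFst [Fintype I] (b : BilOp m Γ R I J K) (w : I → A) (x : J → A) (y : K → A) :
    cls m Γ (pair (b.adjFst w y) x) = cls m Γ (pair w (b.eval x y)) := by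
  simp only [pair, BilOp.adjFst, BilOp.eval, Finsupp.sum, Finset.sum_mul, Finset.mul_sum, map_sum,
    ← cls_mul_mono]
  rw [Finset.sum_comm]
  refine Finset.sum_congr rfl fun i _ => Finset.sum_congr rfl fun j _ =>
    Finset.sum_congr rfl fun k _ => Finset.sum_congr rfl fun s _ => ?_
  congr 1
  ring

theorem BilOp.cls_adjSnd [Fintype I] (b : BilOp m Γ R I J K) (w : I → A) (x : J → A) (y : K → A) :
    cls m Γ (pair (b.adjSnd w x) y) = cls m Γ (pair w (b.eval x y)) := by
  simp only [pair, BilOp.adjSnd, BilOp.eval, Finsupp.sum, Finset.sum_mul, Finset.mul_sum, map_sum,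
    ← cls_mul_mono]
  rw [Finset.sum_comm]
  refine Finset.sum_congr rfl fun i _ => ?_
  rw [Finset.sum_comm]
  refine Finset.sum_congr rfl fun j _ =>
    Finset.sum_congr rfl fun k _ => Finset.sum_congr rfl fun s _ => ?_
  congr 1
  ring

/-- Derivations over `R` that commute with all `∂ₗ` and `ĝ`. -/
structure IsEvol (m : ℕ) (Γ : Type v) [Group Γ] {R : Type u} [CommRing R]
    {A : Type*} [CommRing A] [DDRing m Γ A] [Algebra R A] (D : Derivation R A A) : Prop where
  der : ∀ (l : Fin m) (a : A), D (DDRing.der (Γ := Γ) l a) = DDRing.der (Γ := Γ) l (D a)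
  sh : ∀ (g : Γ) (a : A), D (DDRing.sh m g a) = DDRing.sh m g (D a)

namespace IsEvol

variable {D E : Derivation R A A}

theorem lie (hD : IsEvol m Γ D) (hE : IsEvol m Γ E) : IsEvol m Γ ⁅D, E⁆ where
  der l a := by simp [Derivation.commutator_apply, hD.der, hE.der]
  sh g a := by simp [Derivation.commutator_apply, hD.sh, hE.sh]

theorem map_mono (hD : IsEvol m Γ D) (k : OpIdx m Γ) (a : A) :
    D (mono k a) = mono k (D a) := by
  obtain ⟨g, σ⟩ := k
  induction σ using exponent_induction with
  | h0 => simp [mono, derPow_zero, hD.sh]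
  | h1 σ l ih => rw [mono_add_single, mono_add_single, hD.der, ih]

/-- `D` sends each generator of the trivial elements to one of the same kind, so it descends to the
quotient. -/
theorem cls_congr (hD : IsEvol m Γ D) {a b : A} (h : cls m Γ a = cls m Γ b) :
    cls m Γ (D a) = cls m Γ (D b) := by
  have key : trivials m Γ A ≤ ((cls m Γ).comp D.toLinearMap.toAddMonoidHom).ker := by
    refine (AddSubgroup.closure_le _).2 ?_
    rintro _ (⟨l, b, rfl⟩ | ⟨g, b, rfl⟩)
    · change cls m Γ (D _) = 0
      rw [hD.der, cls_der]
    · change cls m Γ (D _) = 0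
      rw [map_sub, hD.sh, map_sub, cls_sh, sub_self]
  have := key (sim_iff_cls.2 h)
  change cls m Γ (D (a - b)) = 0 at this
  rwa [map_sub, map_sub, sub_eq_zero] at this

theorem map_linEval (hD : IsEvol m Γ D) (L : LinOp m Γ R I J) (x : J → A) :
    D ∘ L.eval x = L.eval (D ∘ x) := by
  ext i
  simp [LinOp.eval, Finsupp.sum, hD.map_mono]

theorem map_bilEval (hD : IsEvol m Γ D) (b : BilOp m Γ R I J K) (x : J → A) (y : K → A) :
    D ∘ b.eval x y = b.eval (D ∘ x) y + b.eval x (D ∘ y) := by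
  ext i
  simp [BilOp.eval, Finsupp.sum, hD.map_mono, ← Finset.sum_add_distrib]
  refine Finset.sum_congr rfl fun j _ => Finset.sum_congr rfl fun k _ =>
    Finset.sum_congr rfl fun s _ => ?_
  ring

end IsEvol

theorem derivation_pair [Fintype I] (D : Derivation R A A) (x y : I → A) :
    D (pair x y) = pair (D ∘ x) y + pair x (D ∘ y) := by
  simp [pair, ← Finset.sum_add_distrib]
  refine Finset.sum_congr rfl fun i _ => ?_
  ring

end Operators

/-! ### Evolutionary derivations and the first variation formula. -/

section Polynomials

variable {m : ℕ} {Γ : Type v} [Group Γ] {R : Type u} [CommRing R] [DDRing m Γ R] {ι : Type}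

theorem DDPoly.isDDExt : IsDDExt m Γ R (DDPoly m Γ R ι) where
  injective := MvPolynomial.C_injective _ _
  map_der l r := (polyDer_C l r).symm
  map_sh g r := (polySh_C g r).symm

/-- The evolutionary derivation with characteristic `Q`. -/
noncomputable def evolDer (Q : ι → DDPoly m Γ R ι) :
    Derivation R (DDPoly m Γ R ι) (DDPoly m Γ R ι) :=
  MvPolynomial.mkDerivation R fun q => mono q.2 (Q q.1)

theorem evolDer_X (Q : ι → DDPoly m Γ R ι) (i : ι) (k : OpIdx m Γ) :
    evolDer Q (MvPolynomial.X (i, k)) = mono k (Q i) := by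
  simp [evolDer]

theorem evolDer_isEvol (Q : ι → DDPoly m Γ R ι) : IsEvol m Γ (evolDer Q) where
  der l a := by
    change evolDer Q (polyDer l a) = polyDer l (evolDer Q a)
    induction a using MvPolynomial.induction_on with
    | C a =>
      rw [polyDer_C, ← MvPolynomial.algebraMap_eq, Derivation.map_algebraMap,
        Derivation.map_algebraMap, map_zero]
    | add p q hp hq => simp [hp, hq]
    | mul_X p q hp =>
      have : evolDer Q (polyDer l (MvPolynomial.X q)) =
          polyDer l (evolDer Q (MvPolynomial.X q)) := by
        rw [polyDer_X, evolDer_X, evolDer_X, mono_add_single]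
        rfl
      simp only [Derivation.leibniz, map_add, smul_eq_mul, hp, this]
      ring
  sh g a := by
    change evolDer Q (polySh g a) = polySh g (evolDer Q a)
    induction a using MvPolynomial.induction_on with
    | C a =>
      rw [polySh_C, ← MvPolynomial.algebraMap_eq, Derivation.map_algebraMap,
        Derivation.map_algebraMap, map_zero]
    | add p q hp hq => simp [hp, hq]
    | mul_X p q hp =>
      have : evolDer Q (polySh g (MvPolynomial.X q)) =
          polySh g (evolDer Q (MvPolynomial.X q)) := by
        rw [polySh_X, evolDer_X, evolDer_X, mono_mul]
        rfl
      simp only [Derivation.leibniz, map_add, map_mul, smul_eq_mul, hp, this]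

theorem sum_smul_pderiv_apply {σ S : Type*} [CommRing S] (s : Finset σ)
    (c : σ → MvPolynomial σ S) (g : MvPolynomial σ S) :
    (∑ v ∈ s, c v • MvPolynomial.pderiv v :
        Derivation S (MvPolynomial σ S) (MvPolynomial σ S)) g =
      ∑ v ∈ s, MvPolynomial.pderiv v g * c v := by
  classical
  induction s using Finset.induction_on with
  | empty => simp
  | insert a s ha ih =>
    rw [Finset.sum_insert ha, Finset.sum_insert ha, Derivation.add_apply, ih, Derivation.smul_apply,
      smul_eq_mul, mul_comm]

theorem derivation_eq_sum_pderiv {σ S : Type*} [CommRing S]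
    (D : Derivation S (MvPolynomial σ S) (MvPolynomial σ S)) (f : MvPolynomial σ S) :
    D f = ∑ v ∈ f.vars, MvPolynomial.pderiv v f * D (MvPolynomial.X v) := by
  classical
  rw [← sum_smul_pderiv_apply f.vars (fun v => D (MvPolynomial.X v)) f]
  refine MvPolynomial.derivation_eq_of_forall_mem_vars fun v hv => ?_
  rw [sum_smul_pderiv_apply, Finset.sum_eq_single_of_mem v hv]
  · simp
  · intro w _ hw
    simp [MvPolynomial.pderiv_X_of_ne hw.symm]

/-- One finite index set, `H.vars`, serves all components `i`, so the sums can be interchanged. -/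
theorem varDer_eq_sum [DecidableEq ι] (H : DDPoly m Γ R ι) (i : ι) :
    varDer H i = ∑ v ∈ H.vars, if v.1 = i then monoAdj v.2 (MvPolynomial.pderiv v H) else 0 := by
  classical
  rw [varDer, ← Finset.sum_filter,
    finsum_eq_sum_of_support_subset (s := (H.vars.filter fun v => v.1 = i).image Prod.snd),
    Finset.sum_image]
  · refine Finset.sum_congr rfl fun v hv => ?_
    rw [← (Finset.mem_filter.1 hv).2]
  · intro v hv w hw h
    simp only [Finset.coe_filter, Set.mem_ofPred_eq] at hv hw
    exact Prod.ext (hv.2.trans hw.2.symm) h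
  · intro k hk
    by_contra hv
    apply hk
    have : (i, k) ∉ H.vars := fun h => hv (by simpa using h)
    simp [MvPolynomial.pderiv_eq_zero_of_notMem_vars this, monoAdj]

theorem mono_X (i : ι) (k : OpIdx m Γ) :
    mono k (MvPolynomial.X (i, 1, 0) : DDPoly m Γ R ι) = MvPolynomial.X (i, k) := by
  obtain ⟨g, σ⟩ := k
  induction σ using exponent_induction with
  | h0 =>
    have := polySh_X (R := R) g ((i, 1, 0) : ι × OpIdx m Γ)
    simp only [mul_one] at this
    rw [← this, mono]
    simp only [derPow_zero, Module.End.one_apply]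
    rfl
  | h1 σ l ih =>
    rw [mono_add_single, ih]
    exact polyDer_X l _

/-- First variation: the chain rule over `H.vars`, with each `ĝ ∂^σ` then moved off `D q_i` by its
adjoint. -/
theorem IsEvol.cls_apply [Fintype ι] {D : Derivation R (DDPoly m Γ R ι) (DDPoly m Γ R ι)}
    (hD : IsEvol m Γ D) (H : DDPoly m Γ R ι) :
    cls m Γ (D H) = cls m Γ (pair (varDer H) fun i => D (MvPolynomial.X (i, 1, 0))) := by
  classical
  simp only [pair, varDer_eq_sum, Finset.sum_mul]
  rw [Finset.sum_comm, derivation_eq_sum_pderiv, map_sum, map_sum]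
  refine Finset.sum_congr rfl fun v _ => ?_
  simp only [ite_mul, zero_mul, Finset.sum_ite_eq, Finset.mem_univ, if_true]
  rw [← cls_mul_mono, ← hD.map_mono, mono_X]

end Polynomials

/-! ### The momentum map, its equivariance, and the Jacobi identity. -/

section Bracket

variable {m : ℕ} {Γ : Type v} [Group Γ] {R : Type u} [CommRing R] [DDRing m Γ R] {N n : ℕ}
  {𝒢 : LieStr m Γ R N}

section Momentum

variable {A : Type*} [CommRing A] [DDRing m Γ A] [Algebra R A]

/-- The dual action on `V*`: `⟨X.w, y⟩ ∼ -⟨w, X.y⟩` for all `y`. -/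
def DDRep.dual (χ : DDRep 𝒢 n) (X : Fin N → A) (w : Fin n → A) : Fin n → A :=
  -χ.op.adjSnd w X

theorem DDRep.cls_dual (χ : DDRep 𝒢 n) (X : Fin N → A) (w y : Fin n → A) :
    cls m Γ (pair y (χ.dual X w)) = -cls m Γ (pair w (χ.op.eval X y)) := by
  rw [pair_comm, DDRep.dual, pair_neg_left, map_neg, BilOp.cls_adjSnd]

theorem DDRep.cls_nabla (χ : DDRep 𝒢 n) (X : Fin N → A) (y w : Fin n → A) :
    cls m Γ (pair (χ.nabla y w) X) = cls m Γ (pair w (χ.op.eval X y)) :=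
  χ.op.cls_adjFst w X y

theorem LieStr.cls_coad (𝒢 : LieStr m Γ R N) (X a Y : Fin N → A) :
    cls m Γ (pair (𝒢.coad X a) Y) = -cls m Γ (pair a (𝒢.op.eval X Y)) := by
  rw [LieStr.coad, pair_neg_left, map_neg, BilOp.cls_adjSnd]

/-- Apply `D` to `⟨y, X.w⟩ ∼ -⟨w, X.y⟩`; the terms containing `D y` cancel by the same relation. No
Leibniz rule for the adjoint operator is needed. -/
theorem IsEvol.cls_map_pair_dual (χ : DDRep 𝒢 n) {D : Derivation R A A} (hD : IsEvol m Γ D)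
    (X : Fin N → A) (w y : Fin n → A) :
    cls m Γ (pair y (D ∘ χ.dual X w)) =
      -cls m Γ (pair (D ∘ w) (χ.op.eval X y)) - cls m Γ (pair w (χ.op.eval (D ∘ X) y)) := by
  have h := hD.cls_congr (m := m) (Γ := Γ) (a := pair y (χ.dual X w))
    (b := -pair w (χ.op.eval X y)) (by rw [χ.cls_dual, map_neg])
  rw [map_neg, derivation_pair, derivation_pair, hD.map_bilEval, pair_add_right, map_neg, map_add,
    map_add, map_add, χ.cls_dual] at h
  grind

end Momentum

theorem cls_oOperator_cocycle {O : LinOp m Γ R (Fin N) (Fin N)} (hO : IsOOperator 𝒢 O)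
    {A : Type (max u v)} [CommRing A] [DDRing m Γ A] [Algebra R A] (hA : IsDDExt m Γ R A)
    (a b c : Fin N → A) :
    cls m Γ (pair a (𝒢.op.eval (O.eval b) (O.eval c)))
      + cls m Γ (pair b (𝒢.op.eval (O.eval c) (O.eval a)))
      + cls m Γ (pair c (𝒢.op.eval (O.eval a) (O.eval b))) = 0 := by
  -- The second argument is chosen so that `O` maps it to `[O(b), O(c)]`; its pairing with `O(a)`
  -- unfolds into the other two terms.
  have h := sim_iff_cls.1 (hO.skew A hA a (𝒢.coad (O.eval b) c - 𝒢.coad (O.eval c) b))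
  rw [hO.hom A hA, map_zero, map_add, pair_sub_left, map_sub, 𝒢.cls_coad, 𝒢.cls_coad,
    𝒢.skew A hA (O.eval b) (O.eval a), pair_neg_right, map_neg] at h
  grind

/-- The covector `x ∇ δH/δx - δH/δp ∇ p` in `𝒢*`. -/
noncomputable def momentum (χ : DDRep 𝒢 n) (H : FunVV m Γ R n) : Fin N → FunVV m Γ R n :=
  χ.nabla xvec (gradx H) - χ.nabla (gradp H) pvec

theorem qbracket_eq (χ : DDRep 𝒢 n) (O : LinOp m Γ R (Fin N) (Fin N)) (H F : FunVV m Γ R n) :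
    qbracket χ O H F = pair (momentum χ H) (O.eval (momentum χ F)) := by
  simp only [qbracket, momentum, LinOp.eval_sub, pair_sub_left, pair_sub_right]
  ring

/-- The evolutionary derivation of the action of `X` on `V ⊕ V*`. -/
noncomputable def actDer (χ : DDRep 𝒢 n) (X : Fin N → FunVV m Γ R n) :
    Derivation R (FunVV m Γ R n) (FunVV m Γ R n) :=
  evolDer (Sum.elim (χ.op.eval X xvec) (χ.dual X pvec))

variable (χ : DDRep 𝒢 n) (X Y : Fin N → FunVV m Γ R n)

theorem actDer_isEvol : IsEvol m Γ (actDer χ X) := evolDer_isEvol _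

theorem actDer_xvec : actDer χ X ∘ xvec = χ.op.eval X xvec := by
  ext1 i
  simp [xvec, actDer, evolDer_X, mono_one]

theorem actDer_pvec : actDer χ X ∘ pvec = χ.dual X pvec := by
  ext1 i
  simp [pvec, actDer, evolDer_X, mono_one]

theorem IsEvol.cls_apply_grad {D : Derivation R (FunVV m Γ R n) (FunVV m Γ R n)}
    (hD : IsEvol m Γ D) (H : FunVV m Γ R n) :
    cls m Γ (D H) = cls m Γ (pair (gradx H) (D ∘ xvec)) + cls m Γ (pair (gradp H) (D ∘ pvec)) := by
  rw [hD.cls_apply, ← map_add, pair, Fintype.sum_sum_type]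
  rfl

theorem cls_actDer (H : FunVV m Γ R n) :
    cls m Γ (actDer χ X H) = cls m Γ (pair (momentum χ H) X) := by
  rw [(actDer_isEvol χ X).cls_apply_grad, actDer_xvec, actDer_pvec, momentum, pair_sub_left,
    map_sub, χ.cls_nabla, χ.cls_nabla, χ.cls_dual, sub_eq_add_neg]

/-- By first variation only the values of the commutator on `x` and `p` matter. Since `D_X (Y.x) =
(D_X Y).x + Y.(X.x)`, the actions compose in reverse order, whence the minus sign before `[X,Y]`. -/
theorem cls_actDer_lie (H : FunVV m Γ R n) :
    cls m Γ (actDer χ X (actDer χ Y H)) - cls m Γ (actDer χ Y (actDer χ X H)) =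
      cls m Γ (actDer χ (actDer χ X ∘ Y) H) - cls m Γ (actDer χ (actDer χ Y ∘ X) H)
        - cls m Γ (actDer χ (𝒢.op.eval X Y) H) := by
  rw [← map_sub, ← Derivation.commutator_apply,
    ((actDer_isEvol χ X).lie (actDer_isEvol χ Y)).cls_apply_grad]
  simp only [(actDer_isEvol χ _).cls_apply_grad H]
  have hx : (⁅actDer χ X, actDer χ Y⁆ : Derivation R _ _) ∘ xvec =
      actDer χ X ∘ (actDer χ Y ∘ xvec) - actDer χ Y ∘ (actDer χ X ∘ xvec) := by
    ext1 i; simp [Derivation.commutator_apply]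
  have hp : (⁅actDer χ X, actDer χ Y⁆ : Derivation R _ _) ∘ pvec =
      actDer χ X ∘ (actDer χ Y ∘ pvec) - actDer χ Y ∘ (actDer χ X ∘ pvec) := by
    ext1 i; simp [Derivation.commutator_apply]
  have hl := χ.map_lie (FunVV m Γ R n) DDPoly.isDDExt X Y
  rw [hx, hp]
  simp only [actDer_xvec, actDer_pvec, (actDer_isEvol χ _).map_bilEval, pair_sub_right,
    pair_add_right, map_sub, map_add, hl, (actDer_isEvol χ _).cls_map_pair_dual, χ.cls_dual]
  -- In the `p` part one dual action remains; moving it across leaves `X.(Y.δH/δp)`, to which `hl`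
  -- compares.
  have h1 := χ.cls_dual X pvec (χ.op.eval Y (gradp H))
  have h2 := χ.cls_dual Y pvec (χ.op.eval X (gradp H))
  rw [pair_comm] at h1 h2
  rw [h1, h2]
  grind

/-- Differentiate `D_Y H ∼ ⟨M_H, Y⟩` along `X` and antisymmetrize: the terms `⟨M_H, D_X Y⟩` and
`⟨M_H, D_Y X⟩` cancel against those of `cls_actDer_lie`. -/
theorem cls_derivation_momentum (H : FunVV m Γ R n) :
    cls m Γ (pair (actDer χ X ∘ momentum χ H) Y) - cls m Γ (pair (actDer χ Y ∘ momentum χ H) X) =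
      -cls m Γ (pair (momentum χ H) (𝒢.op.eval X Y)) := by
  have hX := (actDer_isEvol χ X).cls_congr (cls_actDer χ Y H)
  have hY := (actDer_isEvol χ Y).cls_congr (cls_actDer χ X H)
  have h := cls_actDer_lie χ X Y H
  rw [hX, hY] at h
  simp only [derivation_pair, map_add, cls_actDer] at h
  grind

theorem cls_qbracket_qbracket {O : LinOp m Γ R (Fin N) (Fin N)} (hO : IsOOperator 𝒢 O)
    (H F G : FunVV m Γ R n) :
    cls m Γ (qbracket χ O (qbracket χ O H F) G) =
      cls m Γ (pair (actDer χ (O.eval (momentum χ G)) ∘ momentum χ H) (O.eval (momentum χ F)))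
      - cls m Γ
        (pair (actDer χ (O.eval (momentum χ G)) ∘ momentum χ F) (O.eval (momentum χ H))) := by
  -- `D` commutes with `O`, whose coefficients lie in `R`; skewness then turns `⟨M_H, O(D M_F)⟩`
  -- into `-⟨D M_F, O(M_H)⟩`.
  have h := sim_iff_cls.1 (hO.skew _ DDPoly.isDDExt (momentum χ H)
    (actDer χ (O.eval (momentum χ G)) ∘ momentum χ F))
  rw [map_zero, map_add] at h
  rw [qbracket_eq, ← cls_actDer, qbracket_eq, derivation_pair, (actDer_isEvol χ _).map_linEval,
    map_add]
  grind

end Bracket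

end DiffDiff

theorem proposition9p1 {m : ℕ} {Γ : Type v} [Group Γ] {R : Type u} [CommRing R] [DDRing m Γ R]
    {N n : ℕ} (𝒢 : LieStr m Γ R N) (χ : DDRep 𝒢 n) (O : LinOp m Γ R (Fin N) (Fin N))
    (hO : IsOOperator 𝒢 O) (H F G : FunVV m Γ R n) :
    Sim m Γ
      (qbracket χ O (qbracket χ O H F) G + qbracket χ O (qbracket χ O F G) H
        + qbracket χ O (qbracket χ O G H) F) 0 := by
  rw [sim_iff_cls, map_zero, map_add, map_add]
  simp only [cls_qbracket_qbracket χ hO]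
  -- The six terms pair up by which momentum is differentiated; each pair is one instance of
  -- equivariance.
  have hH := cls_derivation_momentum χ (O.eval (momentum χ F)) (O.eval (momentum χ G)) H
  have hF := cls_derivation_momentum χ (O.eval (momentum χ G)) (O.eval (momentum χ H)) F
  have hG := cls_derivation_momentum χ (O.eval (momentum χ H)) (O.eval (momentum χ F)) G
  have h := cls_oOperator_cocycle hO DDPoly.isDDExt (momentum χ H) (momentum χ F) (momentum χ G)
  grind
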